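/- Let $N\ge 1$, let $(\Omega,\mathcal F,\mathbb P)$ be a probability space, and let $L^\infty(\mathbb R^N)$ be the space of essentially bounded $N$-dimensional random vectors modulo almost sure equality, ordered componentwise almost surely. Lower semicontinuity on $L^\infty(\mathbb R^N)$ and $L^\infty(\mathbb R)$ refers to the weak* topologies induced by $L^1(\mathbb R^N)$ and $L^1(\mathbb R)$; an $\mathbb R^N$-valued functional is lower semicontinuous if each of its components is. For $C\subseteq\mathbb R^N$ let $\operatorname{recc} C=\{y\in\mathbb R^N : \lambda y+C\subseteq C\ \text{for all}\ \lambda>0\}$, and let $\mathcal J$ be the set of closed convex sets $C\subseteq\mathbb R^N$ with $\operatorname{recc} C=\mathbb R^N_+$. Let $R$ assign to every $X\in L^\infty(\mathbb R^N)$ a set $R(X)\subseteq\mathbb R^N$, and suppose that $R$ is a convex set-valued risk measure, that is, for all $X,Y\in L^\infty(\mathbb R^N)$, $m\in\mathbb R^N$ and $\lambda\in(0,1)$: - (monotonicity) $X\ge Y$ implies $R(X)\supseteq R(Y)$; - (cash-additivity) $R(X+m)=R(X)-m$; - (finiteness at zero) $R(0)\notin\{\emptyset,\mathbb R^N\}$;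 - (convexity) $R(\lambda X+(1-\lambda)Y)\supseteq\lambda R(X)+(1-\lambda)R(Y)$. Then the following three properties are equivalent: 1. (vector-basedness) there are a lower semicontinuous $r\colon L^\infty(\mathbb R^N)\to\mathbb R^N$ and $C\in\mathcal J$ such that $R(X)=r(X)+C$ for all $X\in L^\infty(\mathbb R^N)$; 2. (separability) there are set-valued functionals $\bar R_1,\dots,\bar R_N$ from $L^\infty(\mathbb R)$ to subsets of $\mathbb R$ with nonempty compact values, such that each $\min\bar R_i\colon L^\infty(\mathbb R)\to\mathbb R$ is lower semicontinuous, and $C\in\mathcal J$ such that $R(X)=\bar R_1(X_1)\times\dots\times\bar R_N(X_N)+C$ for all $X\in L^\infty(\mathbb R^N)$; 3. (strong separability) there are lower semicontinuous $\bar r_1,\dots,\bar r_N\colon L^\infty(\mathbb R)\to\mathbb R$ and $C\in\mathcal J$ such that $R(X)=(\bar r_1(X_1),\dots,\bar r_N(X_N))^\top+C$ for all $X\in L^\infty(\mathbb R^N)$. If they hold, then $R$ is closed: its graph $\{(X,m)\in L^\infty(\mathbb R^N)\times\mathbb R^N : m\in R(X)\}$ is closed in the product of the weak* topology on $L^\infty(\mathbb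 R^N)$ and the usual topology on $\mathbb R^N$. -/

import Mathlib

open MeasureTheory Set
open scoped ENNReal Pointwise

/-- `L^∞(ℝ)` over the measure space `(Ω, μ)`. -/
abbrev LInf {Ω : Type*} [MeasurableSpace Ω] (μ : Measure Ω) : Type _ :=
  Lp ℝ ∞ μ

/-- `L^∞(ℝ^N)`: essentially bounded `N`-dimensional random vectors up to a.s. equality. -/
abbrev LInfVec {Ω : Type*} [MeasurableSpace Ω] (μ : Measure Ω) (N : ℕ) : Type _ :=
  Lp (Fin N → ℝ) ∞ μ

namespace RiskMeasure

variable {Ω : Type*} [MeasurableSpace Ω] {μ : Measure Ω} {N : ℕ}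

/-- The weak* topology on `L^∞(ℝ)`: the coarsest topology making `X ↦ E[U X]` continuous
for every `U ∈ L^1(ℝ)`. -/
@[reducible]
noncomputable def weakStar (μ : Measure Ω) : TopologicalSpace (LInf μ) :=
  TopologicalSpace.induced (fun (X : LInf μ) (U : Lp ℝ 1 μ) => ∫ ω, U ω * X ω ∂μ)
    Pi.topologicalSpace

/-- The weak* topology on `L^∞(ℝ^N)`: the coarsest topology making `X ↦ E[Uᵀ X]` continuous
for every `U ∈ L^1(ℝ^N)`. -/
@[reducible]
noncomputable def weakStarVec (μ : Measure Ω) (N : ℕ) : TopologicalSpace (LInfVec μ N) :=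
  TopologicalSpace.induced
    (fun (X : LInfVec μ N) (U : Lp (Fin N → ℝ) 1 μ) => ∫ ω, U ω ⬝ᵥ X ω ∂μ)
    Pi.topologicalSpace

/-- Lower semicontinuity of a real functional on `L^∞(ℝ)` for the weak* topology. -/
def WeakStarLSC (f : LInf μ → ℝ) : Prop :=
  @LowerSemicontinuous (LInf μ) ℝ (weakStar μ) _ f

/-- Lower semicontinuity of a real functional on `L^∞(ℝ^N)` for the weak* topology. -/
def WeakStarLSCVec (f : LInfVec μ N → ℝ) : Prop :=
  @LowerSemicontinuous (LInfVec μ N) ℝ (weakStarVec μ N) _ f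

/-- The `i`-th component `X_i ∈ L^∞(ℝ)` of a random vector `X ∈ L^∞(ℝ^N)`. -/
noncomputable def component (X : LInfVec μ N) (i : Fin N) : LInf μ :=
  (ContinuousLinearMap.proj (R := ℝ) (φ := fun _ : Fin N => ℝ) i).compLp X

/-- The recession cone `{y | ∀ t > 0, t y + C ⊆ C}`. -/
def recessionCone (C : Set (Fin N → ℝ)) : Set (Fin N → ℝ) :=
  {y | ∀ t : ℝ, 0 < t → (t • y) +ᵥ C ⊆ C}

/-- Closed convex sets `C ⊆ ℝ^N` whose recession cone is the nonnegative orthant. -/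
def orthantSets (N : ℕ) : Set (Set (Fin N → ℝ)) :=
  {C | IsClosed C ∧ Convex ℝ C ∧ recessionCone C = {x | 0 ≤ x}}

/-- A set-valued risk measure on `L^∞(ℝ^N)`. -/
structure IsSetValuedRiskMeasure [IsFiniteMeasure μ]
    (R : LInfVec μ N → Set (Fin N → ℝ)) : Prop where
  monotone : ∀ X Y : LInfVec μ N, (∀ᵐ ω ∂μ, Y ω ≤ X ω) → R Y ⊆ R X
  cash_additive : ∀ (X : LInfVec μ N) (m : Fin N → ℝ),
    R (X + Lp.const ∞ μ m) = (-m) +ᵥ R X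
  finite_at_zero : R 0 ≠ ∅ ∧ R 0 ≠ univ

/-- Convexity of a set-valued functional. -/
def IsConvex (R : LInfVec μ N → Set (Fin N → ℝ)) : Prop :=
  ∀ (X Y : LInfVec μ N) (t : ℝ), 0 < t → t < 1 →
    t • R X + (1 - t) • R Y ⊆ R (t • X + (1 - t) • Y)

/-- The graph is closed for the product of the weak* topology and the usual topology. -/
def HasClosedGraph (R : LInfVec μ N → Set (Fin N → ℝ)) : Prop :=
  @IsClosed (LInfVec μ N × (Fin N → ℝ))
    (@instTopologicalSpaceProd _ _ (weakStarVec μ N) inferInstance)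
    {p | p.2 ∈ R p.1}

/-- `R(X) = r(X) + C` with `r` (componentwise) weak* lower semicontinuous. -/
def IsVectorBased (R : LInfVec μ N → Set (Fin N → ℝ)) : Prop :=
  ∃ r : LInfVec μ N → (Fin N → ℝ), ∃ C ∈ orthantSets N,
    (∀ i, WeakStarLSCVec fun X => r X i) ∧ ∀ X, R X = r X +ᵥ C

/-- `R(X) = R₁(X₁) × ⋯ × R_N(X_N) + C`, where the `R_i` have nonempty compact values and
`min R_i` (the infimum, attained by compactness) is weak* lower semicontinuous. -/
def IsSeparable (R : LInfVec μ N → Set (Fin N → ℝ)) : Prop :=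
  ∃ Rbar : Fin N → LInf μ → Set ℝ, ∃ C ∈ orthantSets N,
    (∀ i Y, (Rbar i Y).Nonempty ∧ IsCompact (Rbar i Y)) ∧
    (∀ i, WeakStarLSC fun Y => sInf (Rbar i Y)) ∧
    ∀ X, R X = (univ.pi fun i => Rbar i (component X i)) + C

/-- `R(X) = (r₁(X₁), …, r_N(X_N)) + C` with every `r_i` weak* lower semicontinuous. -/
def IsStronglySeparable (R : LInfVec μ N → Set (Fin N → ℝ)) : Prop :=
  ∃ rbar : Fin N → LInf μ → ℝ, ∃ C ∈ orthantSets N,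
    (∀ i, WeakStarLSC (rbar i)) ∧
    ∀ X, R X = (fun i => rbar i (component X i)) +ᵥ C

end RiskMeasure

/-! Since `C ∈ orthantSets N` is convex, `v +ᵥ C ⊆ w +ᵥ C` holds iff `w ≤ v`. Hence if
`R X = r X +ᵥ C`, monotonicity and cash-additivity of `R` pass to `r`. Such an `r` is local:
if `X i ≤ Y i`, then adding a large deterministic amount to the other components of `Y` makes it
dominate `X`, and by cash-additivity this addition does not affect `r Y i`. So `r X i` depends only
on `X i`. Weak* lower semicontinuity survives both passing to components and embedding a scalar
position as one component, as these two maps are adjoint to each other for the pairing of `L^1`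
with `L^∞`. In the separable case each factor may be replaced by its minimum, because `C` is an
upper set; this also makes the preimage of `C` under the upper semicontinuous map
`(X, m) ↦ m - r X` closed, which is the graph of `R`. -/

namespace RiskMeasure

open Filter
open scoped Topology

section UpperSet

theorem isLeast_univ_pi {ι : Type*} {α : ι → Type*} [∀ i, Preorder (α i)]
    {s : ∀ i, Set (α i)} {a : ∀ i, α i} (h : ∀ i, IsLeast (s i) (a i)) :
    IsLeast (univ.pi s) a :=
  ⟨fun i _ => (h i).1, fun _ hb i => (h i).2 (hb i (mem_univ i))⟩

theorem add_eq_vadd_of_isLeast {G : Type*} [AddCommGroup G] [Preorder G] [IsOrderedAddMonoid G]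
    {S C : Set G} {a : G} (hC : IsUpperSet C) (ha : IsLeast S a) : S + C = a +ᵥ C := by
  refine Subset.antisymm (add_subset_iff.2 fun v hv c hc => ?_) (vadd_set_subset_add ha.1)
  exact hC.vadd (add_le_add_left (ha.2 hv) c) (vadd_mem_vadd_set hc)

theorem isClosed_preimage_of_upperSemicontinuous {α ι : Type*} [TopologicalSpace α] [Finite ι]
    {β : ι → Type*} [∀ i, LinearOrder (β i)] [∀ i, TopologicalSpace (β i)]
    [∀ i, OrderTopology (β i)] [∀ i, DenselyOrdered (β i)] [∀ i, NoMaxOrder (β i)]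
    {f : α → ∀ i, β i} (hf : ∀ i, UpperSemicontinuous fun x => f x i)
    {C : Set (∀ i, β i)} (hC : IsClosed C) (hup : IsUpperSet C) : IsClosed (f ⁻¹' C) := by
  refine isOpen_compl_iff.1 (isOpen_iff_mem_nhds.2 fun x hx => ?_)
  have hle : Filter.pi (fun i => 𝓝[>] (f x i)) ≤ 𝓝 (f x) := by
    rw [nhds_pi]
    exact pi_mono fun i => nhdsWithin_le_nhds
  obtain ⟨b, hbC, hlt⟩ := (((hC.isOpen_compl.eventually_mem hx).filter_mono hle).and
    (eventually_pi fun i => self_mem_nhdsWithin)).exists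
  filter_upwards [eventually_all.2 fun i => hf i x (b i) (hlt i)] with y hy hyC
  exact hbC (hup (fun i => (hy i).le) hyC)

end UpperSet

section RecessionCone

theorem nsmul_vadd_subset {M α : Type*} [AddMonoid M] [AddAction M α] {d : M} {s : Set α}
    (h : d +ᵥ s ⊆ s) (n : ℕ) : (n • d) +ᵥ s ⊆ s := by
  induction n with
  | zero => rw [zero_nsmul, zero_vadd]
  | succ n ih =>
    rw [succ_nsmul, add_vadd]
    exact (vadd_set_mono h).trans ih

theorem smul_vadd_subset_of_convex {𝕜 E : Type*} [Field 𝕜] [LinearOrder 𝕜] [IsStrictOrderedRing 𝕜]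
    [Archimedean 𝕜] [AddCommGroup E] [Module 𝕜 E] {C : Set E} (hC : Convex 𝕜 C) {d : E}
    (h : d +ᵥ C ⊆ C) {t : 𝕜} (ht : 0 ≤ t) : (t • d) +ᵥ C ⊆ C := by
  rintro _ ⟨c, hc, rfl⟩
  obtain ⟨n, hn⟩ := exists_nat_gt t
  have hn0 : (0 : 𝕜) < n := ht.trans_lt hn
  have hnd : c + n • d ∈ C := by
    rw [add_comm]
    exact nsmul_vadd_subset h n (vadd_mem_vadd_set hc)
  have hmem := hC.add_smul_mem hc hnd ⟨div_nonneg ht hn0.le, (div_le_one hn0).2 hn.le⟩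
  rwa [← Nat.cast_smul_eq_nsmul 𝕜, smul_smul, div_mul_cancel₀ _ hn0.ne', add_comm] at hmem

variable {N : ℕ} {C : Set (Fin N → ℝ)}

theorem mem_recessionCone_iff_of_convex (hC : Convex ℝ C) {d : Fin N → ℝ} :
    d ∈ recessionCone C ↔ d +ᵥ C ⊆ C :=
  ⟨fun hd => by simpa only [one_smul] using hd 1 one_pos,
    fun h _ ht => smul_vadd_subset_of_convex hC h ht.le⟩

theorem vadd_subset_vadd_iff_of_mem_orthantSets (hC : C ∈ orthantSets N) {v w : Fin N → ℝ} :
    v +ᵥ C ⊆ w +ᵥ C ↔ w ≤ v := by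
  rw [subset_vadd_set_iff, vadd_vadd, ← mem_recessionCone_iff_of_convex hC.2.1, hC.2.2,
    neg_add_eq_sub, mem_ofPred_eq, sub_nonneg]

theorem vadd_left_injective_of_mem_orthantSets (hC : C ∈ orthantSets N) :
    Function.Injective fun v : Fin N → ℝ => v +ᵥ C := fun _ _ h =>
  le_antisymm ((vadd_subset_vadd_iff_of_mem_orthantSets hC).1 h.ge)
    ((vadd_subset_vadd_iff_of_mem_orthantSets hC).1 h.le)

theorem isUpperSet_of_mem_orthantSets (hC : C ∈ orthantSets N) : IsUpperSet C := by
  intro c y hcy hc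
  have h : (y - c) +ᵥ C ⊆ (0 : Fin N → ℝ) +ᵥ C :=
    (vadd_subset_vadd_iff_of_mem_orthantSets hC).2 (sub_nonneg.2 hcy)
  simpa using h (vadd_mem_vadd_set hc)

end RecessionCone

variable {Ω : Type*} [MeasurableSpace Ω] {μ : Measure Ω} {N : ℕ}

section Component

/-- The random vector with `i`-th component `Y` and all other components zero. The exponent is
arbitrary because the same embedding is needed on `L^∞` and on its predual `L^1`. -/
noncomputable def single {p : ℝ≥0∞} (i : Fin N) (Y : Lp ℝ p μ) : Lp (Fin N → ℝ) p μ :=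
  (ContinuousLinearMap.single ℝ (fun _ : Fin N => ℝ) i).compLp Y

theorem coeFn_component (X : LInfVec μ N) (i : Fin N) :
    component X i =ᵐ[μ] fun ω => X ω i :=
  ContinuousLinearMap.coeFn_compLp' _ X

theorem coeFn_single {p : ℝ≥0∞} (i : Fin N) (Y : Lp ℝ p μ) :
    single i Y =ᵐ[μ] fun ω => Pi.single i (Y ω) :=
  ContinuousLinearMap.coeFn_compLp' _ Y

theorem component_single (i : Fin N) (Y : LInf μ) : component (single i Y) i = Y := by
  refine Lp.ext ?_
  filter_upwards [coeFn_component (single i Y) i, coeFn_single i Y] with ω hcomp hsingle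
  rw [hcomp, hsingle, Pi.single_eq_same]

theorem integral_single_dotProduct {p : ℝ≥0∞} (i : Fin N) (U : Lp ℝ p μ) (X : LInfVec μ N) :
    ∫ ω, single i U ω ⬝ᵥ X ω ∂μ = ∫ ω, U ω * component X i ω ∂μ := by
  refine integral_congr_ae ?_
  filter_upwards [coeFn_single i U, coeFn_component X i] with ω hU hX
  rw [hU, hX, single_dotProduct]

theorem integral_dotProduct_single {p q : ℝ≥0∞} (i : Fin N) (U : Lp (Fin N → ℝ) p μ)
    (Y : Lp ℝ q μ) :
    ∫ ω, U ω ⬝ᵥ single i Y ω ∂μ =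
      ∫ ω, (ContinuousLinearMap.proj (R := ℝ) (φ := fun _ : Fin N => ℝ) i).compLp U ω * Y ω ∂μ := by
  refine integral_congr_ae ?_
  filter_upwards [coeFn_single i Y, ContinuousLinearMap.coeFn_compLp
    (ContinuousLinearMap.proj (R := ℝ) (φ := fun _ : Fin N => ℝ) i) U] with ω hY hU
  rw [hY, hU, dotProduct_single, ContinuousLinearMap.proj_apply]

end Component

section WeakStar

theorem continuous_weakStar_iff {α : Type*} [TopologicalSpace α] {f : α → LInf μ} :
    Continuous[_, weakStar μ] f ↔
      ∀ U : Lp ℝ 1 μ, Continuous fun a => ∫ ω, U ω * f a ω ∂μ :=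
  continuous_induced_rng.trans continuous_pi_iff

theorem continuous_weakStarVec_iff {α : Type*} [TopologicalSpace α] {f : α → LInfVec μ N} :
    Continuous[_, weakStarVec μ N] f ↔
      ∀ U : Lp (Fin N → ℝ) 1 μ, Continuous fun a => ∫ ω, U ω ⬝ᵥ f a ω ∂μ :=
  continuous_induced_rng.trans continuous_pi_iff

theorem continuous_component (i : Fin N) :
    Continuous[weakStarVec μ N, weakStar μ] fun X : LInfVec μ N => component X i := by
  let _ := weakStarVec μ N
  refine continuous_weakStar_iff.2 fun U => ?_
  simp only [← integral_single_dotProduct]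
  exact continuous_weakStarVec_iff.1 continuous_id (single i U)

theorem continuous_single (i : Fin N) :
    Continuous[weakStar μ, weakStarVec μ N] (single i : LInf μ → LInfVec μ N) := by
  let _ := weakStar μ
  refine continuous_weakStarVec_iff.2 fun U => ?_
  simp only [integral_dotProduct_single]
  exact continuous_weakStar_iff.1 continuous_id _

theorem WeakStarLSC.comp_component {f : LInf μ → ℝ} (hf : WeakStarLSC f) (i : Fin N) :
    WeakStarLSCVec fun X : LInfVec μ N => f (component X i) :=
  let _ := weakStar μ
  let _ := weakStarVec μ N
  LowerSemicontinuous.comp hf (continuous_component i)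

theorem WeakStarLSCVec.comp_single {f : LInfVec μ N → ℝ} (hf : WeakStarLSCVec f) (i : Fin N) :
    WeakStarLSC fun Y : LInf μ => f (single i Y) :=
  let _ := weakStar μ
  let _ := weakStarVec μ N
  LowerSemicontinuous.comp hf (continuous_single i)

end WeakStar

section Monetary

/-- A monetary (monotone and cash-additive) `ℝ^N`-valued risk measure on `L^∞(ℝ^N)`. It is the
property of the functional `r` in a representation `R X = r X +ᵥ C`, and follows the sign convention
of set-valued risk measures: larger positions have smaller risk. -/
structure IsMonetary [IsFiniteMeasure μ] (r : LInfVec μ N → Fin N → ℝ) : Prop where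
  antitone : ∀ X Y : LInfVec μ N, (∀ᵐ ω ∂μ, Y ω ≤ X ω) → r X ≤ r Y
  cash_additive : ∀ (X : LInfVec μ N) (m : Fin N → ℝ), r (X + Lp.const ∞ μ m) = r X - m

theorem ae_norm_le_norm {E : Type*} [NormedAddCommGroup E] (X : Lp E ∞ μ) :
    ∀ᵐ ω ∂μ, ‖X ω‖ ≤ ‖X‖ := by
  rw [Lp.norm_def, toReal_eLpNorm (Lp.aestronglyMeasurable X)]
  exact ae_le_lpNorm_exponent_top (Lp.memLp X)

variable [IsFiniteMeasure μ] {r : LInfVec μ N → Fin N → ℝ}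

theorem IsMonetary.apply_le_apply_of_component_le (hr : IsMonetary r) {X Y : LInfVec μ N}
    {i : Fin N} (h : component X i ≤ component Y i) : r Y i ≤ r X i := by
  let m : Fin N → ℝ := Function.update (fun _ => ‖X - Y‖) i 0
  have hdom : ∀ᵐ ω ∂μ, X ω ≤ (Y + Lp.const ∞ μ m) ω := by
    filter_upwards [(Lp.coeFn_le _ _).2 h, coeFn_component X i, coeFn_component Y i,
      ae_norm_le_norm (X - Y), Lp.coeFn_sub X Y, Lp.coeFn_add Y (Lp.const ∞ μ m),
      Lp.coeFn_const (p := ∞) (μ := μ) m] with ω hle hX hY hnorm hsub hadd hconst j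
    rw [hX, hY] at hle
    rw [hadd, Pi.add_apply, hconst, Function.const_apply, Pi.add_apply]
    rcases eq_or_ne j i with rfl | hj
    · simpa [m] using hle
    · have hdiff : X ω j - Y ω j ≤ ‖X - Y‖ := by
        rw [hsub] at hnorm
        exact (le_abs_self _).trans ((norm_le_pi_norm (X ω - Y ω) j).trans hnorm)
      simpa [m, hj] using sub_le_iff_le_add'.1 hdiff
  simpa [hr.cash_additive, m] using hr.antitone _ _ hdom i

theorem IsMonetary.apply_eq_apply_single_component (hr : IsMonetary r) (X : LInfVec μ N)
    (i : Fin N) : r X i = r (single i (component X i)) i :=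
  le_antisymm (hr.apply_le_apply_of_component_le (component_single i _).le)
    (hr.apply_le_apply_of_component_le (component_single i _).ge)

theorem IsSetValuedRiskMeasure.isMonetary {R : LInfVec μ N → Set (Fin N → ℝ)}
    (hR : IsSetValuedRiskMeasure R) {C : Set (Fin N → ℝ)} (hC : C ∈ orthantSets N)
    (hrep : ∀ X, R X = r X +ᵥ C) : IsMonetary r where
  antitone X Y hYX := by
    have hsub := hR.monotone X Y hYX
    rwa [hrep, hrep, vadd_subset_vadd_iff_of_mem_orthantSets hC] at hsub
  cash_additive X m := by
    have heq := hR.cash_additive X m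
    rw [hrep, hrep, vadd_vadd, neg_add_eq_sub] at heq
    exact vadd_left_injective_of_mem_orthantSets hC heq

end Monetary

section Representations

variable {R : LInfVec μ N → Set (Fin N → ℝ)}

theorem IsVectorBased.isStronglySeparable [IsFiniteMeasure μ] (h : IsVectorBased R)
    (hR : IsSetValuedRiskMeasure R) : IsStronglySeparable R := by
  obtain ⟨r, C, hC, hlsc, hrep⟩ := h
  have hr : IsMonetary r := hR.isMonetary hC hrep
  refine ⟨fun i Y => r (single i Y) i, C, hC, fun i => (hlsc i).comp_single i, fun X => ?_⟩
  rw [hrep, funext (hr.apply_eq_apply_single_component X)]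

theorem IsStronglySeparable.isVectorBased (h : IsStronglySeparable R) : IsVectorBased R :=
  let ⟨rbar, C, hC, hlsc, hrep⟩ := h
  ⟨fun X i => rbar i (component X i), C, hC, fun i => (hlsc i).comp_component i, hrep⟩

theorem IsStronglySeparable.isSeparable (h : IsStronglySeparable R) : IsSeparable R := by
  obtain ⟨rbar, C, hC, hlsc, hrep⟩ := h
  refine ⟨fun i Y => {rbar i Y}, C, hC, fun i Y => ⟨singleton_nonempty _, isCompact_singleton⟩,
    fun i => by simpa only [csInf_singleton] using hlsc i, fun X => ?_⟩
  rw [hrep, univ_pi_singleton, ← vadd_eq_add, singleton_vadd]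

theorem IsSeparable.isStronglySeparable (h : IsSeparable R) : IsStronglySeparable R := by
  obtain ⟨Rbar, C, hC, hcomp, hlsc, hrep⟩ := h
  refine ⟨fun i Y => sInf (Rbar i Y), C, hC, hlsc, fun X => ?_⟩
  rw [hrep]
  exact add_eq_vadd_of_isLeast (isUpperSet_of_mem_orthantSets hC)
    (isLeast_univ_pi fun i => (hcomp i _).2.isLeast_sInf (hcomp i _).1)

theorem IsVectorBased.hasClosedGraph (h : IsVectorBased R) : HasClosedGraph R := by
  obtain ⟨r, C, hC, hlsc, hrep⟩ := h
  let _ := weakStarVec μ N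
  have hgraph : {p : LInfVec μ N × (Fin N → ℝ) | p.2 ∈ R p.1} =
      (fun p => p.2 - r p.1) ⁻¹' C := by
    ext p
    rw [mem_ofPred_eq, hrep, mem_vadd_set_iff_neg_vadd_mem, vadd_eq_add, neg_add_eq_sub,
      mem_preimage]
  have husc (i : Fin N) :
      UpperSemicontinuous fun p : LInfVec μ N × (Fin N → ℝ) => p.2 i - r p.1 i := by
    have hfst : LowerSemicontinuous fun p : LInfVec μ N × (Fin N → ℝ) => r p.1 i :=
      LowerSemicontinuous.comp (hlsc i) continuous_fst
    have hneg : UpperSemicontinuous fun p : LInfVec μ N × (Fin N → ℝ) => -r p.1 i :=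
      continuous_neg.comp_lowerSemicontinuous_antitone hfst fun _ _ => neg_le_neg
    have hsnd : Continuous fun p : LInfVec μ N × (Fin N → ℝ) => p.2 i := by fun_prop
    simpa only [sub_eq_add_neg] using hsnd.upperSemicontinuous.add hneg
  rw [HasClosedGraph, hgraph]
  exact isClosed_preimage_of_upperSemicontinuous husc hC.1 (isUpperSet_of_mem_orthantSets hC)

end Representations

end RiskMeasure

theorem mainTheorem2_general {Ω : Type*} [MeasurableSpace Ω] {μ : MeasureTheory.Measure Ω}
    [MeasureTheory.IsFiniteMeasure μ] {N : ℕ} {R : LInfVec μ N → Set (Fin N → ℝ)}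
    (hR : RiskMeasure.IsSetValuedRiskMeasure R) :
    [RiskMeasure.IsVectorBased R, RiskMeasure.IsSeparable R,
        RiskMeasure.IsStronglySeparable R].TFAE ∧
      (RiskMeasure.IsVectorBased R → RiskMeasure.HasClosedGraph R) := by
  refine ⟨?_, RiskMeasure.IsVectorBased.hasClosedGraph⟩
  tfae_have 1 → 3 := fun h => h.isStronglySeparable hR
  tfae_have 3 → 2 := RiskMeasure.IsStronglySeparable.isSeparable
  tfae_have 2 → 3 := RiskMeasure.IsSeparable.isStronglySeparable
  tfae_have 3 → 1 := RiskMeasure.IsStronglySeparable.isVectorBased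
  tfae_finish

theorem mainTheorem2 {Ω : Type*} [MeasurableSpace Ω] (μ : MeasureTheory.Measure Ω)
    [MeasureTheory.IsProbabilityMeasure μ] (N : ℕ) (hN : 1 ≤ N)
    (R : LInfVec μ N → Set (Fin N → ℝ))
    (hR : RiskMeasure.IsSetValuedRiskMeasure R) (hconv : RiskMeasure.IsConvex R) :
    [RiskMeasure.IsVectorBased R, RiskMeasure.IsSeparable R,
        RiskMeasure.IsStronglySeparable R].TFAE ∧
      (RiskMeasure.IsVectorBased R → RiskMeasure.HasClosedGraph R) :=
  mainTheorem2_general hR
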